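/- Let $k$ be a field and let $\mathcal C$ be a skeletally small triangulated $k$-category with suspension $\Sigma$ which is Hom-finite (all $\operatorname{Hom}_{\mathcal C}(X,Y)$ are finite dimensional over $k$), Krull–Schmidt (every object is a finite direct sum of objects with local endomorphism rings), and has Serre duality (an autoequivalence $\nu$ of $\mathcal C$ with $k$-linear isomorphisms $\operatorname{Hom}_{\mathcal C}(X,Y)\cong \operatorname{Hom}_k(\operatorname{Hom}_{\mathcal C}(Y,\nu X),k)$ natural in $X$ and $Y$). Let $T$ be a rigid object of $\mathcal C$, i.e. $\operatorname{Hom}_{\mathcal C}(T,\Sigma T)=0$, and let $\mathcal X_T$ be the class of objects $X$ with $\operatorname{Hom}_{\mathcal C}(T,X)=0$. Let $\mathcal C/\mathcal X_T$ be the quotient of $\mathcal C$ by the morphisms factoring through an object of $\mathcal X_T$, let $\mathcal R$ be the class of regular morphisms of $\mathcal C/\mathcal X_T$ (those that are both monomorphisms and epimorphisms), and let $(\mathcal C/\mathcal X_T)_{\mathcal R}$ be the Gabriel–Zisman localisation of $\mathcal C/\mathcal X_T$ at $\mathcal R$. Then: 1. $\mathcal R$ admits a calculus of left fractions and a calculus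 of right fractions; in particular $(\mathcal C/\mathcal X_T)_{\mathcal R}$ inherits from $\mathcal C/\mathcal X_T$ a $k$-linear additive structure for which the localisation functor is $k$-linear. 2. $T$ is a projective generator of $(\mathcal C/\mathcal X_T)_{\mathcal R}$: it is projective there, and every object is a quotient of a finite direct sum of copies of $T$. Moreover the canonical ring homomorphism $\operatorname{End}_{\mathcal C}(T)\to\operatorname{End}_{(\mathcal C/\mathcal X_T)_{\mathcal R}}(T)$ is an isomorphism. 3. The functor $\operatorname{Hom}_{(\mathcal C/\mathcal X_T)_{\mathcal R}}(T,-)$, where $\operatorname{End}_{\mathcal C}(T)^{\mathrm{op}}$ acts by precomposition, takes values in the category $\operatorname{mod}\operatorname{End}_{\mathcal C}(T)^{\mathrm{op}}$ of left $\operatorname{End}_{\mathcal C}(T)^{\mathrm{op}}$-modules that are finite dimensional over $k$, and it is a $k$-linear equivalence $$(\mathcal C/\mathcal X_T)_{\mathcal R}\simeq\operatorname{mod}\operatorname{End}_{\mathcal C}(T)^{\mathrm{op}}.$$ -/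

import Mathlib

open CategoryTheory CategoryTheory.Limits
open scoped ZeroObject

universe w v u v' u'

namespace RigidLoc

section Assumptions

variable (k : Type w) [Field k] (C : Type u) [Category.{v} C] [Preadditive C]

/-- All morphism spaces are finite dimensional over `k`. -/
def IsHomFinite [Linear k C] : Prop :=
  ∀ X Y : C, FiniteDimensional k (X ⟶ Y)

/-- Every object is a finite direct sum (biproduct) of objects with local endomorphism rings. -/
def IsKrullSchmidt : Prop :=
  ∀ X : C, ∃ (n : ℕ) (Y : Fin n → C) (b : Bicone Y),
    Nonempty b.IsBilimit ∧ Nonempty (b.pt ≅ X) ∧ ∀ i, IsLocalRing (End (Y i))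

/-- A Serre duality: an autoequivalence `ν` of `C` with `k`-linear isomorphisms
`Hom(X, Y) ≃ D Hom(Y, ν X)`, natural in `X` and in `Y`, where `D = Hom_k(-, k)`. -/
structure SerreDuality [Linear k C] where
  /-- the Serre functor -/
  ν : C ≌ C
  /-- the duality isomorphisms -/
  iso (X Y : C) : (X ⟶ Y) ≃ₗ[k] Module.Dual k (Y ⟶ ν.functor.obj X)
  naturality_left {X' X Y : C} (f : X' ⟶ X) (g : X ⟶ Y) (h : Y ⟶ ν.functor.obj X') :
    iso X' Y (f ≫ g) h = iso X Y g (h ≫ ν.functor.map f)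
  naturality_right {X Y Y' : C} (g : X ⟶ Y) (f : Y ⟶ Y') (h : Y' ⟶ ν.functor.obj X) :
    iso X Y' (g ≫ f) h = iso X Y g (f ≫ h)

end Assumptions

/-- `T` is rigid: `Ext¹(T, T) = Hom(T, ΣT) = 0`. -/
def IsRigid {C : Type u} [Category.{v} C] [Preadditive C] [HasShift C ℤ] (T : C) : Prop :=
  ∀ f : T ⟶ T⟦(1 : ℤ)⟧, f = 0

section Quotient

variable {C : Type u} [Category.{v} C] [Preadditive C]

/-- The class `𝒳_T` of the objects `X` with `Hom(T, X) = 0`. -/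
def homKernel (T : C) : ObjectProperty C :=
  fun X => ∀ f : T ⟶ X, f = 0

/-- Two parallel morphisms are identified when their difference factors through an object
of `𝒳_T`. -/
def factorRel (T : C) : HomRel C :=
  fun X Y f g => ∃ (Z : C) (_ : homKernel T Z) (a : X ⟶ Z) (b : Z ⟶ Y), f - g = a ≫ b

variable (T : C)

lemma factorRel_add [HasBinaryBiproducts C] ⦃X Y : C⦄ (f₁ f₂ g₁ g₂ : X ⟶ Y) (hf : factorRel T f₁ f₂)
    (hg : factorRel T g₁ g₂) : factorRel T (f₁ + g₁) (f₂ + g₂) := by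
  obtain ⟨Z, hZ, a, b, h⟩ := hf
  obtain ⟨Z', hZ', a', b', h'⟩ := hg
  refine ⟨Z ⊞ Z', fun t => ?_, biprod.lift a a', biprod.desc b b', ?_⟩
  · apply biprod.hom_ext
    · rw [hZ (t ≫ biprod.fst), zero_comp]
    · rw [hZ' (t ≫ biprod.snd), zero_comp]
  · rw [biprod.lift_desc, ← h, ← h']
    abel

lemma factorRel_refl [HasZeroObject C] {X Y : C} (f : X ⟶ Y) : factorRel T f f := by
  refine ⟨(0 : C), fun t => ?_, 0, 0, by simp⟩
  exact (isZero_zero C).eq_of_tgt _ _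

lemma factorRel_smul (k : Type w) [Field k] [Linear k C] (c : k) ⦃X Y : C⦄ (f g : X ⟶ Y) (h : factorRel T f g) :
    factorRel T (c • f) (c • g) := by
  obtain ⟨Z, hZ, a, b, h⟩ := h
  exact ⟨Z, hZ, c • a, b, by rw [← smul_sub, h, Linear.smul_comp]⟩

variable [HasZeroObject C] [HasBinaryBiproducts C]

instance factorRel_congruence : Congruence (factorRel T) where
  comp_left := by
    rintro X Y Z f g g' ⟨W, hW, a, b, h⟩
    exact ⟨W, hW, f ≫ a, b, by rw [← Preadditive.comp_sub, h, Category.assoc]⟩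
  comp_right := by
    rintro X Y Z f f' g ⟨W, hW, a, b, h⟩
    exact ⟨W, hW, a, b ≫ g, by rw [← Preadditive.sub_comp, h, Category.assoc]⟩
  equivalence := by
    intro X Y
    refine ⟨factorRel_refl T, ?_, ?_⟩
    · rintro f g ⟨W, hW, a, b, h⟩
      exact ⟨W, hW, -a, b, by rw [Preadditive.neg_comp, ← h]; abel⟩
    · intro f g h h₁ h₂
      obtain ⟨W, hW, a, b, e⟩ := factorRel_add T _ _ _ _ h₁ h₂
      exact ⟨W, hW, a, b, by rw [← e]; abel⟩

/-- The additive quotient `C/𝒳_T`: same objects as `C`, morphisms modulo those that factor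
through an object of `𝒳_T`. -/
abbrev QuotientCat : Type u := CategoryTheory.Quotient (factorRel T)

/-- The projection functor `C ⥤ C/𝒳_T`. -/
abbrev proj : C ⥤ QuotientCat T := CategoryTheory.Quotient.functor (factorRel T)

instance quotientPreadditive : Preadditive (QuotientCat T) :=
  CategoryTheory.Quotient.preadditive (factorRel T) (factorRel_add T)

instance proj_additive : (proj T).Additive :=
  CategoryTheory.Quotient.functor_additive (factorRel T) (factorRel_add T)

variable (k : Type w) [Field k] [Linear k C]

instance quotientLinear : Linear k (QuotientCat T) :=
  CategoryTheory.Quotient.linear k (factorRel T) (factorRel_smul T k)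

instance proj_linear : (proj T).Linear k :=
  CategoryTheory.Quotient.linear_functor k (factorRel T) (factorRel_smul T k)

end Quotient

/-- The class of regular morphisms: those that are both monomorphisms and epimorphisms. -/
def regularMorphisms (A : Type u) [Category.{v} A] : MorphismProperty A :=
  fun _ _ f => Mono f ∧ Epi f

section Localisation

variable {C : Type u} [Category.{v} C] [Preadditive C] [HasZeroObject C]
  [HasBinaryBiproducts C] (T : C)

/-- The class `ℛ` of regular morphisms of `C/𝒳_T`. -/
abbrev regular : MorphismProperty (QuotientCat T) := regularMorphisms (QuotientCat T)

/-- The Gabriel-Zisman localisation `(C/𝒳_T)_ℛ`. When `ℛ` admits a calculus of left fractions,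
Mathlib endows it with the additive and `k`-linear structures for which the localisation functor
is additive and `k`-linear. -/
noncomputable abbrev LocCat : Type u := (regular T).Localization

/-- The canonical functor `C ⥤ C/𝒳_T ⥤ (C/𝒳_T)_ℛ`. -/
noncomputable abbrev toLoc : C ⥤ LocCat T := proj T ⋙ (regular T).Q

end Localisation

section Modules

variable {C : Type u} [Category.{v} C] [Preadditive C] {E : Type u'} [Category.{v'} E]
  [Preadditive E]

/-- The ring homomorphism `End(T) → End(F T)` induced by an additive functor `F`. -/
def mapEndRingHom (F : C ⥤ E) [F.Additive] (T : C) : End T →+* End (F.obj T) where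
  __ := F.mapEnd T
  map_zero' := F.map_zero T T
  map_add' := fun _ _ => F.map_add

/-- The functor `Hom_E(F T, -)` with values in the category of left modules over `End(T)ᵒᵖ`,
which acts on `Hom_E(F T, Y)` through `F` by precomposition. -/
noncomputable def homFunctor (F : C ⥤ E) [F.Additive] (T : C) : E ⥤ ModuleCat.{v'} (End T)ᵐᵒᵖ :=
  preadditiveCoyonedaObj (F.obj T) ⋙ ModuleCat.restrictScalars (mapEndRingHom F T).op

variable (k : Type w) [Field k]

/-- The modules over a `k`-algebra `Γ` which are finite dimensional over `k`. -/
def isFinDim (Γ : Type v) [Ring Γ] [Algebra k Γ] : ObjectProperty (ModuleCat.{v'} Γ) :=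
  fun M => letI : Module k M := ModuleCat.moduleOfAlgebraModule M
    FiniteDimensional k M

/-- The category `mod Γ` of finite dimensional (left) modules over a `k`-algebra `Γ`. -/
abbrev FinMod (Γ : Type v) [Ring Γ] [Algebra k Γ] : Type (max v (v' + 1)) :=
  (isFinDim.{w, v, v'} k Γ).FullSubcategory

/-- The functor `Hom_E(F T, -)` regarded as a functor to `mod End(T)ᵒᵖ`, when its values are
finite dimensional over `k`. -/
noncomputable abbrev homFunctorFin [Linear k C] (F : C ⥤ E) [F.Additive] (T : C)
    (h : ∀ Y : E, isFinDim k (End T)ᵐᵒᵖ ((homFunctor F T).obj Y)) :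
    E ⥤ FinMod.{w, v, v'} k (End T)ᵐᵒᵖ :=
  (isFinDim k (End T)ᵐᵒᵖ).lift (homFunctor F T) h

end Modules

/-- `P` is a projective generator of `E`: it is projective, and every object is a quotient
of a finite direct sum of copies of `P`. -/
structure IsProjectiveGenerator {E : Type u} [Category.{v} E] [Preadditive E] (P : E) : Prop where
  projective : Projective P
  exists_epi (X : E) : ∃ (n : ℕ) (b : Bicone (fun _ : Fin n => P)) (π : b.pt ⟶ X),
    Nonempty b.IsBilimit ∧ Epi π

end RigidLoc

open RigidLoc

namespace RigidLoc

/-! Write H = Hom_C(T, -). For a triangle T^m → T^n → X, rigidity makes H(T^n) → H(X) surjective, so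
H(X) is the cokernel of H(T^m) → H(T^n). In the same way the cone of a right approximation T^n → X
lies in 𝒳_T. Hence H is faithful on C/𝒳_T (`factorRel_iff`), and a morphism there is regular exactly
when H inverts it (`regular_proj_map_iff`).

Every X receives an H-isomorphism from some cone X' of a map T^m → T^n
(`exists_presented_resolution`), and every End(T)-linear map H(X') → H(Y) comes from a morphism
(`IsPresentedBy.exists_hom`). This yields right fractions and the fullness of H on the localisation.
Such cones also realise all finite dimensional modules (`exists_linearEquiv_hom`).

Left fractions come from the dual construction with S = νT (`exists_ore_square`): by Serre duality,
Hom(T, f) is the dual of Hom(f, S) (`SerreDuality.bijective_comp_iff`). -/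

open Pretriangulated

/-! ### Approximations by finite sums of one object -/

section Approximations

variable {k : Type w} [Field k] {C : Type u} [Category.{v} C] [Preadditive C] [Linear k C]
  [HasFiniteBiproducts C]

/-- A subspace of `Hom(T, X)` stable under `End(T)` is the image of composition with a morphism
from a finite direct sum of copies of `T`. -/
lemma exists_biproduct_hom_of_submodule (hfin : IsHomFinite k C) {T X : C}
    (K : Submodule k (T ⟶ X)) (hK : ∀ (e : T ⟶ T), ∀ t ∈ K, e ≫ t ∈ K) :
    ∃ (n : ℕ) (u : (⨁ fun _ : Fin n => T) ⟶ X), ∀ t, t ∈ K ↔ ∃ t', t' ≫ u = t := by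
  have := hfin T X
  obtain ⟨n, s, hs⟩ := Submodule.fg_iff_exists_fin_generating_family.1
    (IsNoetherian.noetherian K)
  refine ⟨n, biproduct.desc s, fun t => ⟨fun ht => ?_, ?_⟩⟩
  · rw [← hs] at ht
    obtain ⟨c, rfl⟩ := (Submodule.mem_span_range_iff_exists_fun k).1 ht
    refine ⟨biproduct.lift fun i => c i • 𝟙 T, ?_⟩
    simp [biproduct.lift_desc]
  · rintro ⟨t', rfl⟩
    have : t' ≫ biproduct.desc s = ∑ i, (t' ≫ biproduct.π _ i) ≫ s i := by
      rw [← biproduct.lift_desc]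
      congr 1
      ext i
      simp
    rw [this]
    refine Submodule.sum_mem _ fun i _ => hK _ _ ?_
    rw [← hs]
    exact Submodule.subset_span ⟨i, rfl⟩

/-- Right approximations by finite direct sums of copies of `T`. -/
lemma exists_right_approximation (hfin : IsHomFinite k C) (T X : C) :
    ∃ (n : ℕ) (u : (⨁ fun _ : Fin n => T) ⟶ X), ∀ t : T ⟶ X, ∃ t', t' ≫ u = t := by
  obtain ⟨n, u, hu⟩ := exists_biproduct_hom_of_submodule hfin (⊤ : Submodule k (T ⟶ X)) (by simp)
  exact ⟨n, u, fun t => (hu t).1 trivial⟩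

/-- Left approximations by finite direct sums of copies of `S`. -/
lemma exists_left_approximation (hfin : IsHomFinite k C) (S X : C) :
    ∃ (n : ℕ) (u : X ⟶ (⨁ fun _ : Fin n => S)), ∀ t : X ⟶ S, ∃ t', u ≫ t' = t := by
  have := hfin X S
  obtain ⟨n, s, hs⟩ := Submodule.fg_iff_exists_fin_generating_family.1
    (IsNoetherian.noetherian (⊤ : Submodule k (X ⟶ S)))
  refine ⟨n, biproduct.lift s, fun t => ?_⟩
  have ht : t ∈ Submodule.span k (Set.range s) := hs ▸ trivial
  obtain ⟨c, rfl⟩ := (Submodule.mem_span_range_iff_exists_fun k).1 ht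
  refine ⟨biproduct.desc fun i => c i • 𝟙 S, ?_⟩
  simp [biproduct.lift_desc]

end Approximations

/-! ### Cones over sums of T, and the dual fibres over sums of S -/

section Triangulated

variable {C : Type u} [Category.{v} C] [Preadditive C] [HasZeroObject C] [HasShift C ℤ]
  [∀ n : ℤ, (shiftFunctor C n).Additive] [Pretriangulated C]

lemma IsRigid.eq_zero {T : C} (hT : IsRigid T) {n : ℕ}
    (f : T ⟶ (⨁ fun _ : Fin n => T)⟦(1 : ℤ)⟧) : f = 0 := by
  have h := congrArg (shiftFunctor C (1 : ℤ)).map (biproduct.total (f := fun _ : Fin n => T))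
  rw [Functor.map_sum, CategoryTheory.Functor.map_id] at h
  rw [← Category.comp_id f, ← h, Preadditive.comp_sum]
  refine Finset.sum_eq_zero fun i _ => ?_
  rw [Functor.map_comp, ← Category.assoc, hT (f ≫ _), zero_comp]

/-- `X` is the cone of a morphism between finite direct sums of copies of `T`. -/
def IsPresentedBy (T X : C) : Prop :=
  ∃ (m n : ℕ) (u : (⨁ fun _ : Fin m => T) ⟶ (⨁ fun _ : Fin n => T))
    (p : (⨁ fun _ : Fin n => T) ⟶ X) (δ : X ⟶ (⨁ fun _ : Fin m => T)⟦(1 : ℤ)⟧),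
    Triangle.mk u p δ ∈ distTriang C

lemma exists_lift_of_cone {T : C} (hT : IsRigid T) {m : ℕ} {Y X : C}
    {u : (⨁ fun _ : Fin m => T) ⟶ Y} {p : Y ⟶ X}
    {δ : X ⟶ (⨁ fun _ : Fin m => T)⟦(1 : ℤ)⟧} (h : Triangle.mk u p δ ∈ distTriang C)
    (t : T ⟶ X) : ∃ t', t' ≫ p = t := by
  obtain ⟨t', ht'⟩ := Triangle.coyoneda_exact₃ _ h t (hT.eq_zero _)
  exact ⟨t', ht'.symm⟩

lemma exists_cone_hom {X X' Y Z Z' : C} {u' : X' ⟶ Y} {p' : Y ⟶ Z'} {δ' : Z' ⟶ X'⟦(1 : ℤ)⟧}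
    {u : X ⟶ Y} {p : Y ⟶ Z} {δ : Z ⟶ X⟦(1 : ℤ)⟧} (h' : Triangle.mk u' p' δ' ∈ distTriang C)
    (h : Triangle.mk u p δ ∈ distTriang C) (c : X' ⟶ X) (hc : c ≫ u = u') :
    ∃ s : Z' ⟶ Z, p' ≫ s = p := by
  obtain ⟨s, hs, -⟩ := complete_distinguished_triangle_morphism _ _ h' h c (𝟙 Y)
    ((Category.comp_id _).trans hc.symm)
  exact ⟨s, hs.trans (Category.id_comp _)⟩

lemma exists_fiber_hom {X X' Y Z Z' : C} {u : X ⟶ Y} {p : Y ⟶ Z} {δ : Z ⟶ X⟦(1 : ℤ)⟧}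
    {u' : X' ⟶ Y} {p' : Y ⟶ Z'} {δ' : Z' ⟶ X'⟦(1 : ℤ)⟧} (h : Triangle.mk u p δ ∈ distTriang C)
    (h' : Triangle.mk u' p' δ' ∈ distTriang C) (c : Z ⟶ Z') (hc : p ≫ c = p') :
    ∃ s : X ⟶ X', u = s ≫ u' := by
  obtain ⟨s, hs, -⟩ := complete_distinguished_triangle_morphism₁ _ _ h h' (𝟙 Y) c
    (hc.trans (Category.id_comp _).symm)
  exact ⟨s, (Category.comp_id _).symm.trans hs⟩

lemma comp_eq_zero_iff_of_distTriang {T X Y Z : C} {u : X ⟶ Y} {p : Y ⟶ Z}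
    {δ : Z ⟶ X⟦(1 : ℤ)⟧} (h : Triangle.mk u p δ ∈ distTriang C)
    (t : T ⟶ Y) : t ≫ p = 0 ↔ ∃ t', t' ≫ u = t := by
  refine ⟨fun ht => ?_, ?_⟩
  · obtain ⟨t', ht'⟩ := Triangle.coyoneda_exact₂ _ h t ht
    exact ⟨t', ht'.symm⟩
  · rintro ⟨t', rfl⟩
    have : u ≫ p = 0 := comp_distTriang_mor_zero₁₂ _ h
    rw [Category.assoc, this, comp_zero]

/-- On cones of morphisms between direct sums of copies of `T`, every `End(T)`-equivariant map
between the values of `Hom(T, -)` is induced by a morphism. -/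
lemma IsPresentedBy.exists_hom {T X : C} (hX : IsPresentedBy T X) (hT : IsRigid T) {Y : C}
    (ψ : (T ⟶ X) →+ (T ⟶ Y)) (hψ : ∀ (e : T ⟶ T) (t : T ⟶ X), ψ (e ≫ t) = e ≫ ψ t) :
    ∃ g : X ⟶ Y, ∀ t, t ≫ g = ψ t := by
  obtain ⟨m, n, u, p, δ, h⟩ := hX
  -- The components of `p` lie in Hom(T, X); their images under `ψ` are the components that `p ≫ g`
  -- must have.
  let q : (⨁ fun _ : Fin n => T) ⟶ Y := 
    biproduct.desc fun i => ψ (biproduct.ι (fun _ : Fin n => T) i ≫ p)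
  have key : ∀ t : T ⟶ _, t ≫ q = ψ (t ≫ p) := by
    intro t
    have ht : t = ∑ i, (t ≫ biproduct.π (fun _ : Fin n => T) i) ≫ biproduct.ι (fun _ : Fin n => T) i := by
      simp_rw [Category.assoc]
      rw [← Preadditive.comp_sum, biproduct.total, Category.comp_id]
    rw [ht]
    simp only [Preadditive.sum_comp, map_sum]
    refine Finset.sum_congr rfl fun i _ => ?_
    rw [Category.assoc, Category.assoc _ _ p, hψ]
    simp [q]
  have hu : u ≫ q = 0 := by
    ext i
    have : u ≫ p = 0 := comp_distTriang_mor_zero₁₂ _ h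
    rw [← Category.assoc, key, Category.assoc, this]
    simp
  obtain ⟨g, hg⟩ : ∃ g : X ⟶ Y, q = p ≫ g := Triangle.yoneda_exact₂ _ h q hu
  refine ⟨g, fun t => ?_⟩
  obtain ⟨t', rfl⟩ := exists_lift_of_cone hT h t
  rw [← key, hg, Category.assoc]

/-- The cone of a right approximation of `X` lies in `𝒳_T`. -/
lemma homKernel_of_right_approximation {T : C} (hT : IsRigid T) {n : ℕ} {X V : C}
    {u : (⨁ fun _ : Fin n => T) ⟶ X} (hu : ∀ t : T ⟶ X, ∃ t', t' ≫ u = t)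
    {a : X ⟶ V} {b : V ⟶ (⨁ fun _ : Fin n => T)⟦(1 : ℤ)⟧}
    (h : Triangle.mk u a b ∈ distTriang C) : homKernel T V := by
  intro t
  obtain ⟨t', rfl⟩ := exists_lift_of_cone hT h t
  exact (comp_eq_zero_iff_of_distTriang h t').2 (hu t')

section

variable {k : Type w} [Field k] [Linear k C]

/-- For a rigid object `T`, two morphisms are identified in `C/𝒳_T` as soon as they have the same
image under `Hom(T, -)`. -/
lemma factorRel_iff (hfin : IsHomFinite k C) {T : C} (hT : IsRigid T) {X Y : C} (f g : X ⟶ Y) :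
    factorRel T f g ↔ ∀ t : T ⟶ X, t ≫ f = t ≫ g := by
  constructor
  · rintro ⟨Z, hZ, a, b, h⟩ t
    rw [← sub_eq_zero, ← Preadditive.comp_sub, h, ← Category.assoc, hZ (t ≫ a), zero_comp]
  · intro h
    obtain ⟨n, u, hu⟩ := exists_right_approximation hfin T X
    obtain ⟨V, a, b, hV⟩ := distinguished_cocone_triangle u
    obtain ⟨c, hc⟩ := Triangle.yoneda_exact₂ _ hV (f - g) (by
      change u ≫ (f - g) = 0
      ext i
      rw [Preadditive.comp_sub, Preadditive.comp_sub, ← Category.assoc, ← Category.assoc, h]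
      simp)
    exact ⟨V, homKernel_of_right_approximation hT hu hV, a, c, hc⟩

/-- Every object receives, from the cone of a morphism between direct sums of copies of `T`,
a morphism inverted by `Hom(T, -)`. -/
lemma exists_presented_resolution (hfin : IsHomFinite k C) {T : C} (hT : IsRigid T) (X : C) :
    ∃ (X' : C) (s : X' ⟶ X), IsPresentedBy T X' ∧
      Function.Bijective (fun t : T ⟶ X' => t ≫ s) := by
  obtain ⟨n, p, hp⟩ := exists_right_approximation hfin T X
  -- Replacing the fibre `U` of `p` by an approximation T^m → U does not change the image of Hom(T,
  -- U) in Hom(T, T^n), so Hom(T, -) does not see the change of cone.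
  obtain ⟨U, a, b, hU⟩ := distinguished_cocone_triangle₁ p
  obtain ⟨m, c, hc⟩ := exists_right_approximation hfin T U
  obtain ⟨X', p', δ, hX'⟩ := distinguished_cocone_triangle (c ≫ a)
  obtain ⟨s, hs⟩ := exists_cone_hom hX' hU c rfl
  refine ⟨X', s, ⟨m, n, _, _, _, hX'⟩, ?_, ?_⟩
  · suffices ∀ t : T ⟶ X', t ≫ s = 0 → t = 0 by
      intro t₁ t₂ h
      rw [← sub_eq_zero]
      refine this _ ?_
      rw [Preadditive.sub_comp, sub_eq_zero]
      exact h
    intro t ht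
    obtain ⟨t, rfl⟩ := exists_lift_of_cone hT hX' t
    rw [Category.assoc, hs] at ht
    obtain ⟨r, rfl⟩ := (comp_eq_zero_iff_of_distTriang hU t).1 ht
    obtain ⟨r, rfl⟩ := hc r
    exact (comp_eq_zero_iff_of_distTriang hX' _).2 ⟨r, by simp⟩
  · intro t
    obtain ⟨t, rfl⟩ := hp t
    exact ⟨t ≫ p', by dsimp; rw [Category.assoc, hs]⟩

lemma biproduct_desuspension_eq_zero {S : C} (hS : ∀ f : S⟦(-1 : ℤ)⟧ ⟶ S, f = 0) {n : ℕ}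
    (f : (⨁ fun _ : Fin n => S)⟦(-1 : ℤ)⟧ ⟶ S) : f = 0 := by
  have h := congrArg (shiftFunctor C (-1 : ℤ)).map (biproduct.total (f := fun _ : Fin n => S))
  rw [Functor.map_sum, CategoryTheory.Functor.map_id] at h
  rw [← Category.id_comp f, ← h, Preadditive.sum_comp]
  refine Finset.sum_eq_zero fun i _ => ?_
  rw [Functor.map_comp, Category.assoc, hS (_ ≫ f), comp_zero]

/-- Morphisms inverted by `Hom(-, S)` satisfy the Ore condition for left fractions, up to
morphisms killed by `Hom(-, S)`. -/
lemma exists_ore_square (hfin : IsHomFinite k C) {S : C}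
    (hS : ∀ f : S⟦(-1 : ℤ)⟧ ⟶ S, f = 0) {X X' Y : C} (s : X ⟶ X')
    (hs : Function.Bijective (fun h : X' ⟶ S => s ≫ h)) (f : X ⟶ Y) :
    ∃ (Y' : C) (c : Y ⟶ Y') (f' : X' ⟶ Y'), Function.Bijective (fun h : Y' ⟶ S => c ≫ h) ∧
      ∀ h : Y' ⟶ S, (f ≫ c - s ≫ f') ≫ h = 0 := by
  obtain ⟨n, a, ha⟩ := exists_left_approximation hfin S Y
  -- Dual of the resolution by sums of T: the cone of `a` is approximated on the left by S^m, and
  -- `Y'` is the fibre of S^n → S^m.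
  obtain ⟨V, v, v', hV⟩ := distinguished_cocone_triangle a
  obtain ⟨m, w, hw⟩ := exists_left_approximation hfin S V
  obtain ⟨Y', b, δ, hY'⟩ := distinguished_cocone_triangle₁ (v ≫ w)
  have hb : ∀ h : Y' ⟶ S, ∃ h', b ≫ h' = h := fun h => by
    obtain ⟨h', e⟩ := Triangle.yoneda_exact₂ _ (inv_rot_of_distTriang _ hY') h
      (biproduct_desuspension_eq_zero hS _)
    exact ⟨h', e.symm⟩
  have hbv : b ≫ v ≫ w = 0 := comp_distTriang_mor_zero₁₂ _ hY'
  obtain ⟨c, hc⟩ := exists_fiber_hom hV hY' w rfl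
  -- extend `X ⟶ Y ⟶ ⨁ S` to `X'`
  choose e he using fun i => hs.2 ((f ≫ a) ≫ biproduct.π _ i)
  have he' : s ≫ biproduct.lift e = f ≫ a := by
    ext i
    rw [Category.assoc, biproduct.lift_π]
    exact he i
  -- Vanishing may be tested after precomposing with `s`, where the composite factors through `b ≫ v
  -- ≫ w`.
  have hz : biproduct.lift e ≫ v ≫ w = 0 := by
    ext i
    rw [Category.assoc]
    apply hs.1
    dsimp only
    rw [← Category.assoc, he', hc]
    simp only [Category.assoc, zero_comp, comp_zero]
    rw [reassoc_of% hbv]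
    simp
  obtain ⟨f', hf'⟩ := (comp_eq_zero_iff_of_distTriang hY' _).1 hz
  refine ⟨Y', c, f', ⟨?_, ?_⟩, ?_⟩
  · suffices ∀ t : Y' ⟶ S, c ≫ t = 0 → t = 0 by
      intro t₁ t₂ h
      rw [← sub_eq_zero]
      refine this _ ?_
      rw [Preadditive.comp_sub, sub_eq_zero]
      exact h
    intro t ht
    obtain ⟨t, rfl⟩ := hb t
    rw [← Category.assoc, ← hc] at ht
    obtain ⟨r, rfl⟩ : ∃ r : V ⟶ S, t = v ≫ r := Triangle.yoneda_exact₂ _ hV t ht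
    obtain ⟨r, rfl⟩ := hw r
    rw [reassoc_of% hbv, zero_comp]
  · intro h
    obtain ⟨h', rfl⟩ := ha h
    exact ⟨b ≫ h', by dsimp; rw [← Category.assoc, ← hc]⟩
  · intro h
    obtain ⟨h, rfl⟩ := hb h
    rw [Preadditive.sub_comp, sub_eq_zero]
    simp only [Category.assoc]
    rw [reassoc_of% hf', reassoc_of% he', ← Category.assoc c, ← hc]

end

end Triangulated

/-! ### Serre duality: exchanging Hom(T, -) and Hom(-, νT) -/

section Serre

variable {k : Type w} [Field k] {C : Type u} [Category.{v} C] [Preadditive C] [Linear k C]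

namespace SerreDuality

variable (D : SerreDuality k C) (T : C)

/-- By naturality the duality is a trace pairing: it depends only on the composite `t ≫ h`. -/
lemma iso_apply {Y : C} (t : T ⟶ Y) (h : Y ⟶ D.ν.functor.obj T) :
    D.iso T Y t h = D.iso T T (𝟙 T) (t ≫ h) := by
  rw [← D.naturality_right, Category.id_comp]

variable {T}

lemma hom_eq_zero_of_forall {Y : C} (h : Y ⟶ D.ν.functor.obj T)
    (H : ∀ t : T ⟶ Y, t ≫ h = 0) : h = 0 := by
  rw [← Module.forall_dual_apply_eq_zero_iff k]
  intro φ
  obtain ⟨t, rfl⟩ := (D.iso T Y).surjective φ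
  rw [iso_apply, H, map_zero]

lemma hom_eq_zero_of_forall' {Y : C} (t : T ⟶ Y)
    (H : ∀ h : Y ⟶ D.ν.functor.obj T, t ≫ h = 0) : t = 0 := by
  apply (D.iso T Y).injective
  ext h
  rw [iso_apply, H, map_zero, map_zero, LinearMap.zero_apply]

lemma comp_eq_zero_iff {X Y : C} (f : X ⟶ Y) :
    (∀ t : T ⟶ X, t ≫ f = 0) ↔ ∀ h : Y ⟶ D.ν.functor.obj T, f ≫ h = 0 := by
  refine ⟨fun H h => D.hom_eq_zero_of_forall _ fun t => ?_,
    fun H t => D.hom_eq_zero_of_forall' _ fun h => ?_⟩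
  · rw [← Category.assoc, H, zero_comp]
  · rw [Category.assoc, H, comp_zero]

/-- The duality isomorphisms identify Hom(T, f) with the transpose of Hom(f, νT), and a linear map
is bijective iff its transpose is. -/
lemma bijective_comp_iff {X Y : C} (f : X ⟶ Y) :
    Function.Bijective (fun t : T ⟶ X => t ≫ f) ↔
      Function.Bijective (fun h : Y ⟶ D.ν.functor.obj T => f ≫ h) := by
  let F : (Y ⟶ D.ν.functor.obj T) →ₗ[k] (X ⟶ D.ν.functor.obj T) := Linear.leftComp k _ f
  change _ ↔ Function.Bijective F
  rw [← LinearMap.dualMap_bijective_iff]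
  have e : (D.iso T Y) ∘ (fun t : T ⟶ X => t ≫ f) = F.dualMap ∘ (D.iso T X) := by
    funext t
    ext h
    exact D.naturality_right t f h
  rw [← Function.Bijective.of_comp_iff' (D.iso T Y).bijective, e,
    Function.Bijective.of_comp_iff _ (D.iso T X).bijective]

variable [HasShift C ℤ]

/-- Any T → Σ⁻¹νT suspends to a map ΣT → νT, and Hom(ΣT, νT) is dual to Hom(T, ΣT) = 0. By
nondegeneracy of the pairing this forces `f` to vanish. -/
lemma desuspension_eq_zero [(shiftFunctor C (1 : ℤ)).Additive] (hT : IsRigid T)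
    (f : (D.ν.functor.obj T)⟦(-1 : ℤ)⟧ ⟶ D.ν.functor.obj T) : f = 0 := by
  refine D.hom_eq_zero_of_forall _ fun t => ?_
  have : t = 0 := by
    apply (shiftFunctor C (1 : ℤ)).map_injective
    rw [Functor.map_zero, ← cancel_mono ((shiftNegShift (D.ν.functor.obj T) (1 : ℤ)).hom),
      zero_comp]
    exact D.hom_eq_zero_of_forall _ fun y => by rw [hT y, zero_comp]
  rw [this, zero_comp]

end SerreDuality

end Serre

/-! ### Regular morphisms of C/𝒳_T and their calculi of fractions -/

instance isMultiplicative_regularMorphisms (A : Type u) [Category.{v} A] :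
    (regularMorphisms A).IsMultiplicative where
  id_mem _ := ⟨inferInstance, inferInstance⟩
  comp_mem _ _ hf hg :=
    have := hf.1
    have := hf.2
    have := hg.1
    have := hg.2
    ⟨mono_comp _ _, epi_comp _ _⟩

section

variable {k : Type w} [Field k] {C : Type u} [Category.{v} C] [Preadditive C] [Linear k C]
  [HasZeroObject C] [HasShift C ℤ] [∀ n : ℤ, (shiftFunctor C n).Additive] [Pretriangulated C]

lemma proj_map_eq_iff (hfin : IsHomFinite k C) {T : C} (hT : IsRigid T) {X Y : C} (f g : X ⟶ Y) :
    (proj T).map f = (proj T).map g ↔ ∀ t : T ⟶ X, t ≫ f = t ≫ g :=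
  (CategoryTheory.Quotient.functor_map_eq_iff _ _ _).trans (factorRel_iff hfin hT f g)

lemma proj_map_injective (T : C) {X : C} (f g : T ⟶ X)
    (h : (proj T).map f = (proj T).map g) : f = g := by
  obtain ⟨Z, hZ, a, b, e⟩ := (CategoryTheory.Quotient.functor_map_eq_iff _ _ _).1 h
  rw [← sub_eq_zero, e, hZ a, zero_comp]

/-- The map from Y to the cone of `f` kills `f`, so it vanishes in C/𝒳_T if `f` is epi there;
exactness of Hom(T, -) then gives surjectivity. -/
lemma epi_proj_map_iff (hfin : IsHomFinite k C) {T : C} (hT : IsRigid T) {X Y : C} (f : X ⟶ Y) :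
    Epi ((proj T).map f) ↔ Function.Surjective (fun t : T ⟶ X => t ≫ f) := by
  constructor
  · intro _ t
    obtain ⟨Z, g, δ, hZ⟩ := distinguished_cocone_triangle f
    have hfg : f ≫ g = 0 := comp_distTriang_mor_zero₁₂ _ hZ
    have : (proj T).map g = (proj T).map 0 := by
      rw [← cancel_epi ((proj T).map f), ← Functor.map_comp, ← Functor.map_comp, hfg, comp_zero]
    refine (comp_eq_zero_iff_of_distTriang hZ t).1 ?_
    rw [(proj_map_eq_iff hfin hT _ _).1 this, comp_zero]
  · intro h
    constructor
    rintro ⟨Z⟩ a b hab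
    obtain ⟨a, rfl⟩ := (proj T).map_surjective (X := Y) (Y := Z) a
    obtain ⟨b, rfl⟩ := (proj T).map_surjective (X := Y) (Y := Z) b
    refine (proj_map_eq_iff hfin hT _ _).2 fun t => ?_
    obtain ⟨t, rfl⟩ := h t
    have := (proj_map_eq_iff hfin hT (f ≫ a) (f ≫ b)).1 (by simpa using hab) t
    simpa using this

lemma mono_proj_map_iff (hfin : IsHomFinite k C) {T : C} (hT : IsRigid T) {X Y : C} (f : X ⟶ Y) :
    Mono ((proj T).map f) ↔ Function.Injective (fun t : T ⟶ X => t ≫ f) := by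
  constructor
  · intro _ a b hab
    apply proj_map_injective T
    rw [← cancel_mono ((proj T).map f), ← Functor.map_comp, ← Functor.map_comp]
    exact congrArg _ hab
  · intro h
    constructor
    rintro ⟨Z⟩ a b hab
    obtain ⟨a, rfl⟩ := (proj T).map_surjective (X := Z) (Y := X) a
    obtain ⟨b, rfl⟩ := (proj T).map_surjective (X := Z) (Y := X) b
    refine (proj_map_eq_iff hfin hT _ _).2 fun t => h ?_
    have := (proj_map_eq_iff hfin hT (a ≫ f) (b ≫ f)).1 (by simpa using hab) t
    simpa using this

/-- The regular morphisms of `C/𝒳_T` are those inverted by `Hom(T, -)`. -/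
lemma regular_proj_map_iff (hfin : IsHomFinite k C) {T : C} (hT : IsRigid T) {X Y : C}
    (f : X ⟶ Y) :
    regular T ((proj T).map f) ↔ Function.Bijective (fun t : T ⟶ X => t ≫ f) :=
  and_congr (mono_proj_map_iff hfin hT f) (epi_proj_map_iff hfin hT f)

/-- Every morphism to `Y'` from a cone of a map between sums of copies of `T` lifts along a
morphism `Y ⟶ Y'` inverted by `Hom(T, -)`. -/
lemma IsPresentedBy.exists_lift {T X : C} (hX : IsPresentedBy T X) (hT : IsRigid T) {Y Y' : C}
    (s : Y ⟶ Y') (hs : Function.Bijective (fun t : T ⟶ Y => t ≫ s)) (f : X ⟶ Y') :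
    ∃ g : X ⟶ Y, ∀ t : T ⟶ X, t ≫ g ≫ s = t ≫ f := by
  choose ψ hψ using fun t : T ⟶ X => hs.2 (t ≫ f)
  dsimp at hψ
  obtain ⟨g, hg⟩ := hX.exists_hom hT
    (AddMonoidHom.mk' ψ fun a b => hs.1 (by simp [hψ]))
    (fun e t => hs.1 (by simp [hψ]))
  exact ⟨g, fun t => by rw [← Category.assoc, hg]; exact hψ t⟩

/-- The denominator is the resolution X' → X, since morphisms from X' lift along `s`. Cancellation
is automatic because regular morphisms are mono. -/
lemma hasRightCalculusOfFractions_regular (hfin : IsHomFinite k C) {T : C} (hT : IsRigid T) :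
    (regular T).HasRightCalculusOfFractions where
  exists_rightFraction := by
    rintro ⟨X⟩ ⟨Y⟩ ⟨(f : (proj T).obj X ⟶ _), s, hs⟩
    rename_i Y'
    obtain ⟨Y'⟩ := Y'
    obtain ⟨f, rfl⟩ := (proj T).map_surjective (X := X) (Y := Y') f
    obtain ⟨s, rfl⟩ := (proj T).map_surjective (X := Y) (Y := Y') s
    obtain ⟨X', r, hX', hr⟩ := exists_presented_resolution hfin hT X
    obtain ⟨g, hg⟩ := hX'.exists_lift hT s ((regular_proj_map_iff hfin hT s).1 hs) (r ≫ f)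
    refine ⟨⟨(proj T).map r, (regular_proj_map_iff hfin hT r).2 hr, (proj T).map g⟩, ?_⟩
    refine ((proj_map_eq_iff hfin hT (r ≫ f) (g ≫ s)).2 fun t => ?_)
    rw [hg]
  ext X Y Y' f₁ f₂ s hs h :=
    have := hs.1
    ⟨X, 𝟙 X, (regular T).id_mem X, by rw [(cancel_mono s).1 h]⟩

lemma hasLeftCalculusOfFractions_regular (hfin : IsHomFinite k C) (D : SerreDuality k C)
    {T : C} (hT : IsRigid T) : (regular T).HasLeftCalculusOfFractions where
  exists_leftFraction := by
    rintro ⟨X'⟩ ⟨Y⟩ ⟨s, hs, f⟩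
    rename_i X
    obtain ⟨X⟩ := X
    obtain ⟨f, rfl⟩ := (proj T).map_surjective (X := X) (Y := Y) f
    obtain ⟨s, rfl⟩ := (proj T).map_surjective (X := X) (Y := X') s
    obtain ⟨Y', c, f', hc, h⟩ := exists_ore_square hfin (D.desuspension_eq_zero hT) s
      ((D.bijective_comp_iff s).1 ((regular_proj_map_iff hfin hT s).1 hs)) f
    refine ⟨⟨(proj T).map f', (proj T).map c,
      (regular_proj_map_iff hfin hT c).2 ((D.bijective_comp_iff c).2 hc)⟩, ?_⟩
    refine ((proj_map_eq_iff hfin hT (f ≫ c) (s ≫ f')).2 fun t => ?_)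
    rw [← sub_eq_zero, ← Preadditive.comp_sub]
    exact (D.comp_eq_zero_iff _).2 h t
  ext X' X Y f₁ f₂ s hs h :=
    have := hs.2
    ⟨Y, 𝟙 Y, (regular T).id_mem Y, by rw [(cancel_epi s).1 h]⟩

end

/-! ### The localisation and its equivalence with finite dimensional modules -/

lemma exists_toLoc_obj_eq {C : Type u} [Category.{v} C] [Preadditive C] (T : C) (Y : LocCat T) :
    ∃ X : C, (toLoc T).obj X = Y := by
  obtain ⟨⟨X⟩, rfl⟩ := (Localization.Construction.objEquiv (regular T)).surjective Y
  exact ⟨X, rfl⟩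

section

variable {k : Type w} [Field k] {C : Type u} [Category.{v} C] [Preadditive C] [Linear k C]
  [HasZeroObject C] [HasShift C ℤ] [∀ n : ℤ, (shiftFunctor C n).Additive] [Pretriangulated C]

lemma isIso_toLoc_map (hfin : IsHomFinite k C) {T : C} (hT : IsRigid T) {X Y : C} (s : X ⟶ Y)
    (hs : Function.Bijective (fun t : T ⟶ X => t ≫ s)) : IsIso ((toLoc T).map s) :=
  Localization.inverts (regular T).Q (regular T) _ ((regular_proj_map_iff hfin hT s).2 hs)

lemma exists_right_fraction (hfin : IsHomFinite k C) {T : C} (hT : IsRigid T) {X Y : C}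
    (φ : (toLoc T).obj X ⟶ (toLoc T).obj Y) :
    ∃ (X' : C) (s : X' ⟶ X) (g : X' ⟶ Y), Function.Bijective (fun t : T ⟶ X' => t ≫ s) ∧
      (toLoc T).map s ≫ φ = (toLoc T).map g := by
  have := hasRightCalculusOfFractions_regular hfin hT
  obtain ⟨⟨s, hs, g⟩, hψ⟩ := Localization.exists_rightFraction (regular T).Q (regular T)
    (X := (proj T).obj X) (Y := (proj T).obj Y) φ
  rename_i X'
  obtain ⟨X'⟩ := X'
  obtain ⟨s, rfl⟩ := (proj T).map_surjective (X := X') (Y := X) s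
  obtain ⟨g, rfl⟩ := (proj T).map_surjective (X := X') (Y := Y) g
  refine ⟨X', s, g, (regular_proj_map_iff hfin hT s).1 hs, ?_⟩
  rw [hψ]
  exact MorphismProperty.RightFraction.map_s_comp_map
    (⟨(proj T).map s, hs, (proj T).map g⟩ : (regular T).RightFraction _ _) (regular T).Q
    (Localization.inverts _ _)

lemma toLoc_map_eq_iff (hfin : IsHomFinite k C) {T : C} (hT : IsRigid T) {X Y : C} (f g : X ⟶ Y) :
    (toLoc T).map f = (toLoc T).map g ↔ ∀ t : T ⟶ X, t ≫ f = t ≫ g := by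
  rw [← proj_map_eq_iff hfin hT]
  refine ⟨fun h => ?_, fun h => congrArg (fun x => (regular T).Q.map x) h⟩
  have := hasRightCalculusOfFractions_regular hfin hT
  obtain ⟨Z, s, hs, e⟩ := (MorphismProperty.map_eq_iff_precomp (regular T).Q (regular T) _ _).1 h
  have := hs.2
  exact (cancel_epi s).1 e

/-- Surjectivity: the denominator X' → T of a right fraction is inverted by Hom(T, -), so the
identity of T lifts through it and the fraction becomes a morphism of C. -/
lemma toLoc_map_bijective (hfin : IsHomFinite k C) {T : C} (hT : IsRigid T) (X : C) :
    Function.Bijective (fun t : T ⟶ X => (toLoc T).map t) := by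
  constructor
  · intro a b h
    simpa using (toLoc_map_eq_iff hfin hT a b).1 h (𝟙 T)
  · intro φ
    obtain ⟨X', s, g, hs, e⟩ := exists_right_fraction hfin hT φ
    obtain ⟨t, ht⟩ := hs.2 (𝟙 T)
    refine ⟨t ≫ g, ?_⟩
    dsimp only at ht ⊢
    rw [Functor.map_comp, ← e, ← Category.assoc, ← Functor.map_comp, ht,
      CategoryTheory.Functor.map_id, Category.id_comp]

/-- `T` is projective in the localisation. -/
lemma surjective_of_epi (hfin : IsHomFinite k C) {T : C} (hT : IsRigid T) {X Y : LocCat T}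
    (f : X ⟶ Y) [Epi f] (y : (toLoc T).obj T ⟶ Y) : ∃ x, x ≫ f = y := by
  obtain ⟨X, rfl⟩ := exists_toLoc_obj_eq T X
  obtain ⟨Y, rfl⟩ := exists_toLoc_obj_eq T Y
  obtain ⟨X', s, g, hs, e⟩ := exists_right_fraction hfin hT f
  have := isIso_toLoc_map hfin hT s hs
  have : Epi ((toLoc T).map g) := e ▸ epi_comp _ _
  -- The localisation functor is faithful because denominators are epi, so it reflects epimorphisms.
  have : Epi ((proj T).map g) := by
    constructor
    intro Z a b hab
    have hQ : (regular T).Q.map a = (regular T).Q.map b := by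
      rw [← cancel_epi ((toLoc T).map g)]
      exact ((regular T).Q.map_comp _ _).symm.trans
        ((congrArg _ hab).trans ((regular T).Q.map_comp _ _))
    have := hasRightCalculusOfFractions_regular hfin hT
    obtain ⟨Z, s, hs, e⟩ :=
      (MorphismProperty.map_eq_iff_precomp (regular T).Q (regular T) _ _).1 hQ
    have := hs.2
    exact (cancel_epi s).1 e
  obtain ⟨y, rfl⟩ := (toLoc_map_bijective hfin hT Y).2 y
  obtain ⟨x, rfl⟩ := (epi_proj_map_iff hfin hT g).1 this y
  exact ⟨(toLoc T).map (x ≫ s), by rw [Functor.map_comp, Category.assoc, e, ← Functor.map_comp]⟩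

/-- Every finite dimensional `End(T)ᵒᵖ`-module is of the form `Hom_C(T, X)`. -/
lemma exists_linearEquiv_hom (hfin : IsHomFinite k C) {T : C} (hT : IsRigid T)
    (M : ModuleCat.{v'} (End T)ᵐᵒᵖ) (hM : isFinDim k (End T)ᵐᵒᵖ M) :
    ∃ X : C, Nonempty ((T ⟶ X) ≃ₗ[(End T)ᵐᵒᵖ] M) := by
  let : Module k M := ModuleCat.moduleOfAlgebraModule M
  have : FiniteDimensional k M := hM
  obtain ⟨n, s, hs⟩ := Submodule.fg_iff_exists_fin_generating_family.1
    (IsNoetherian.noetherian (⊤ : Submodule k M))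
  -- a surjection from the module `Hom(T, T^n)`
  let θ : (T ⟶ ⨁ fun _ : Fin n => T) →ₗ[(End T)ᵐᵒᵖ] M :=
    { toFun := fun t => ∑ i, @MulOpposite.op (End T) (t ≫ biproduct.π _ i) • s i
      map_add' := fun a b => by
        rw [← Finset.sum_add_distrib]
        refine Finset.sum_congr rfl fun i _ => ?_
        rw [← add_smul, ← MulOpposite.op_add, Preadditive.add_comp]
      map_smul' := fun e t => by
        rw [RingHom.id_apply, Finset.smul_sum]
        refine Finset.sum_congr rfl fun i _ => ?_
        rw [smul_smul]
        congr 1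
        exact congrArg MulOpposite.op (Category.assoc _ _ _) }
  have hθ : Function.Surjective θ := fun x => by
    have hx : x ∈ Submodule.span k (Set.range s) := hs ▸ trivial
    obtain ⟨c, rfl⟩ := (Submodule.mem_span_range_iff_exists_fun k).1 hx
    refine ⟨biproduct.lift fun i => c i • 𝟙 T, ?_⟩
    change ∑ i, @MulOpposite.op (End T) (biproduct.lift _ ≫ biproduct.π (fun _ : Fin n => T) i) •
      s i = _
    refine Finset.sum_congr rfl fun i _ => ?_
    rw [biproduct.lift_π]
    rfl
  have smul_hom : ∀ (c : k) (t : T ⟶ ⨁ fun _ : Fin n => T),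
      c • t = algebraMap k (End T)ᵐᵒᵖ c • t := fun c t => by
    change c • t = (c • 𝟙 T) ≫ t
    simp
  let K : Submodule k (T ⟶ ⨁ fun _ : Fin n => T) :=
    { LinearMap.ker θ with
      smul_mem' := fun c t ht => by
        rw [smul_hom]
        exact (LinearMap.ker θ).smul_mem _ ht }
  -- The image of Hom(T, f) is ker θ, so the cone of `f` has Hom(T, X) ≅ Hom(T, T^n)/ker θ ≅ M.
  obtain ⟨m, f, hf⟩ := exists_biproduct_hom_of_submodule hfin K
    (fun e t ht => (LinearMap.ker θ).smul_mem (MulOpposite.op e) ht)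
  obtain ⟨X, p, δ, hX⟩ := distinguished_cocone_triangle f
  let π : (T ⟶ ⨁ fun _ : Fin n => T) →ₗ[(End T)ᵐᵒᵖ] (T ⟶ X) :=
    { toFun := fun t => t ≫ p
      map_add' := fun _ _ => Preadditive.add_comp _ _ _ _ _ _
      map_smul' := fun _ _ => Category.assoc _ _ _ }
  have hπ : Function.Surjective π := exists_lift_of_cone hT hX
  have hker : LinearMap.ker π = LinearMap.ker θ := by
    ext t
    exact (comp_eq_zero_iff_of_distTriang hX t).trans (hf t).symm
  exact ⟨X, ⟨(π.quotKerEquivOfSurjective hπ).symm ≪≫ₗ Submodule.quotEquivOfEq _ _ hker ≪≫ₗ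
    θ.quotKerEquivOfSurjective hθ⟩⟩

variable {T : C} [(regular T).HasLeftCalculusOfFractions]

/-- `Hom_C(T, X)` and the value at `X` of `homFunctor` are isomorphic `End(T)ᵒᵖ`-modules. -/
noncomputable def homLinearEquiv (hfin : IsHomFinite k C) (hT : IsRigid T) (X : C) :
    (T ⟶ X) ≃ₗ[(End T)ᵐᵒᵖ] (homFunctor (toLoc T) T).obj ((toLoc T).obj X) :=
  LinearEquiv.ofBijective
    ({ toFun := fun t => (toLoc T).map t
       map_add' := fun _ _ => (toLoc T).map_add
       map_smul' := fun _ _ => (toLoc T).map_comp _ _ } :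
      (T ⟶ X) →ₗ[(End T)ᵐᵒᵖ] (homFunctor (toLoc T) T).obj ((toLoc T).obj X)) (toLoc_map_bijective hfin hT X)

lemma mapEndRingHom_toLoc_bijective (hfin : IsHomFinite k C) (hT : IsRigid T) :
    Function.Bijective (mapEndRingHom (toLoc T) T) :=
  toLoc_map_bijective hfin hT T

lemma isFinDim_homFunctor (hfin : IsHomFinite k C) (hT : IsRigid T) (Y : LocCat T) :
    isFinDim k (End T)ᵐᵒᵖ ((homFunctor (toLoc T) T).obj Y) := by
  obtain ⟨X, rfl⟩ := exists_toLoc_obj_eq T Y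
  let : Module k ((homFunctor (toLoc T) T).obj ((toLoc T).obj X)) :=
    ModuleCat.moduleOfAlgebraModule _
  have := hfin T X
  let e := homLinearEquiv hfin hT X
  let f : (T ⟶ X) →ₗ[k] (homFunctor (toLoc T) T).obj ((toLoc T).obj X) :=
    { toFun := e
      map_add' := map_add e
      map_smul' := fun c t => by
        have h : c • t = algebraMap k (End T)ᵐᵒᵖ c • t := by
          change c • t = (c • 𝟙 T) ≫ t
          simp
        rw [h, map_smul]
        rfl }
  exact Module.Finite.of_surjective f e.surjective

lemma homFunctor_faithful (hfin : IsHomFinite k C) (hT : IsRigid T) :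
    (homFunctor (toLoc T) T).Faithful where
  map_injective {X Y} a b h := by
    obtain ⟨X, rfl⟩ := exists_toLoc_obj_eq T X
    obtain ⟨Y, rfl⟩ := exists_toLoc_obj_eq T Y
    have h' : ∀ x : (toLoc T).obj T ⟶ (toLoc T).obj X, x ≫ a = x ≫ b := fun x =>
      ConcreteCategory.congr_hom h x
    rw [← sub_eq_zero]
    obtain ⟨X', s, g, hs, e⟩ := exists_right_fraction hfin hT (a - b)
    have := isIso_toLoc_map hfin hT s hs
    rw [← cancel_epi ((toLoc T).map s), e, comp_zero, ← (toLoc T).map_zero,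
      toLoc_map_eq_iff hfin hT]
    intro t
    apply (toLoc_map_bijective hfin hT Y).1
    dsimp only
    rw [comp_zero, Functor.map_zero, Functor.map_comp, ← e, ← Category.assoc,
      Preadditive.comp_sub, h', sub_self]

lemma homFunctor_full (hfin : IsHomFinite k C) (hT : IsRigid T) :
    (homFunctor (toLoc T) T).Full where
  map_surjective {X Y} φ := by
    obtain ⟨X, rfl⟩ := exists_toLoc_obj_eq T X
    obtain ⟨Y, rfl⟩ := exists_toLoc_obj_eq T Y
    -- In the localisation X may be replaced by X', from which linear maps of Hom-modules are
    -- induced by morphisms of C.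
    obtain ⟨X', s, hX', hs⟩ := exists_presented_resolution hfin hT X
    have := isIso_toLoc_map hfin hT s hs
    let eX := homLinearEquiv hfin hT X'
    let eY := homLinearEquiv hfin hT Y
    let ψ : (T ⟶ X') →ₗ[(End T)ᵐᵒᵖ] (T ⟶ Y) :=
      eY.symm.toLinearMap ∘ₗ ((homFunctor (toLoc T) T).map ((toLoc T).map s) ≫ φ).hom ∘ₗ
        eX.toLinearMap
    obtain ⟨g, hg⟩ := hX'.exists_hom hT ψ.toAddMonoidHom
      (fun e t => ψ.map_smul (MulOpposite.op e) t)
    refine ⟨inv ((toLoc T).map s) ≫ (toLoc T).map g, ?_⟩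
    rw [← cancel_epi ((homFunctor (toLoc T) T).map ((toLoc T).map s)), ← Functor.map_comp,
      IsIso.hom_inv_id_assoc]
    ext x
    obtain ⟨t, rfl⟩ := eX.surjective x
    have h₁ : (homFunctor (toLoc T) T).map ((toLoc T).map g) (eX t) = eY (t ≫ g) :=
      ((toLoc T).map_comp t g).symm
    refine h₁.trans ?_
    rw [hg]
    exact eY.apply_symm_apply _

lemma homFunctorFin_isEquivalence (hfin : IsHomFinite k C) (hT : IsRigid T)
    (h : ∀ X : LocCat T, isFinDim k (End T)ᵐᵒᵖ ((homFunctor (toLoc T) T).obj X)) :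
    (homFunctorFin k (toLoc T) T h).IsEquivalence := by
  have := homFunctor_faithful hfin hT
  have := homFunctor_full hfin hT
  refine { essSurj := ⟨fun M => ?_⟩ }
  obtain ⟨X, ⟨e⟩⟩ := exists_linearEquiv_hom hfin hT M.obj M.property
  exact ⟨(toLoc T).obj X, ⟨ObjectProperty.isoMk _
    ((homLinearEquiv hfin hT X).symm ≪≫ₗ e).toModuleIso⟩⟩

lemma homFunctorFin_linear
    (h : ∀ X : LocCat T, isFinDim k (End T)ᵐᵒᵖ ((homFunctor (toLoc T) T).obj X)) :
    (homFunctorFin k (toLoc T) T h).Linear k where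
  map_smul {X Y} f c := by
    apply (isFinDim k (End T)ᵐᵒᵖ).ι.map_injective
    -- A scalar acts on these modules through End(T)ᵒᵖ, that is, by precomposition with `c • 𝟙 T`.
    have key (x : (toLoc T).obj T ⟶ X) : x ≫ (c • f) = (toLoc T).map (c • 𝟙 T) ≫ x ≫ f := by
      rw [Functor.map_smul, CategoryTheory.Functor.map_id, Linear.smul_comp, Category.id_comp,
        Linear.comp_smul]
    ext x
    exact key x

lemma isProjectiveGenerator (hfin : IsHomFinite k C) (hT : IsRigid T) :
    IsProjectiveGenerator ((toLoc T).obj T) where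
  projective := ⟨fun f e _ => surjective_of_epi hfin hT e f⟩
  exists_epi Y := by
    obtain ⟨X, rfl⟩ := exists_toLoc_obj_eq T Y
    obtain ⟨n, p, hp⟩ := exists_right_approximation hfin T X
    refine ⟨n, (toLoc T).mapBicone (biproduct.bicone fun _ : Fin n => T), (toLoc T).map p,
      ⟨isBilimitOfPreserves (toLoc T) (biproduct.isBilimit _)⟩, ⟨fun a b hab => ?_⟩⟩
    have := homFunctor_faithful hfin hT
    apply (homFunctor (toLoc T) T).map_injective
    have key (x : (toLoc T).obj T ⟶ (toLoc T).obj X) : x ≫ a = x ≫ b := by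
      obtain ⟨t, rfl⟩ := (toLoc_map_bijective hfin hT X).2 x
      obtain ⟨t, rfl⟩ := hp t
      dsimp only
      rw [Functor.map_comp, Category.assoc]
      exact (congrArg _ hab).trans (Category.assoc _ _ _).symm
    ext x
    exact key x

end

end RigidLoc

open RigidLoc
theorem theorem5p3 (k : Type w) [Field k]
    (C : Type u) [Category.{v} C] [EssentiallySmall.{v} C]
    [Preadditive C] [Linear k C] [HasZeroObject C] [HasShift C ℤ]
    [∀ n : ℤ, (shiftFunctor C n).Additive] [∀ n : ℤ, (shiftFunctor C n).Linear k]
    [Pretriangulated C] [IsTriangulated C]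
    (hfin : IsHomFinite k C) (hKS : IsKrullSchmidt C) (hSerre : Nonempty (SerreDuality k C))
    (T : C) (hT : IsRigid T) :
    (regular T).HasRightCalculusOfFractions ∧
    ∃ _ : (regular T).HasLeftCalculusOfFractions,
      IsProjectiveGenerator ((toLoc T).obj T) ∧
      Function.Bijective (mapEndRingHom (toLoc T) T) ∧
      ∃ hmod : ∀ X : LocCat T, isFinDim k (End T)ᵐᵒᵖ ((homFunctor (toLoc T) T).obj X),
        (homFunctorFin k (toLoc T) T hmod).IsEquivalence ∧
        (homFunctorFin k (toLoc T) T hmod).Linear k := by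
  obtain ⟨D⟩ := hSerre
  refine ⟨hasRightCalculusOfFractions_regular hfin hT,
    hasLeftCalculusOfFractions_regular hfin D hT, ?_⟩
  have := hasLeftCalculusOfFractions_regular hfin D hT
  exact ⟨isProjectiveGenerator hfin hT, mapEndRingHom_toLoc_bijective hfin hT,
    isFinDim_homFunctor hfin hT, homFunctorFin_isEquivalence hfin hT _, homFunctorFin_linear _⟩
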